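/- Let $K$ be a number field with ring of integers $\mathcal O_K$, put $\delta_K=[K:\mathbb Q]$, and let $E$ be a non-zero projective $\mathcal O_K$-module of finite rank $r$. Write $E_K=K\otimes_{\mathcal O_K}E$ and, for every embedding $\sigma:K\to\mathbb C$, $E_\sigma=\mathbb C\otimes_{\mathcal O_K,\sigma}E$. Let $g=(\|\cdot\|_\sigma)_\sigma$ and $g'=(\|\cdot\|'_\sigma)_\sigma$ be two families of norms on the spaces $E_\sigma$, each invariant by complex conjugation, and assume that every $\|\cdot\|'_\sigma$ is Hermitian. Define \[D(E,g,g')=\max_{\sigma:K\to\mathbb C}\ \sup_{0\ne s\in E_\sigma}\bigl|\log\|s\|_\sigma-\log\|s\|'_\sigma\bigr|.\] The minimum filtration of $(E,g)$ is defined, for $t\in\mathbb R$, by \[\mathcal F^M_tE_K=\mathrm{Vect}_K\{s\in E\ :\ \|s\|_\sigma\le e^{-t}\text{ for all }\sigma:K\to\mathbb C\}.\] For a Hermitian vector bundle $\overline F$ over $\mathrm{Spec}\,\mathcal O_K$ of rank $a$, the Arakelov degree is \[\widehat{\deg}(\overline F)=\log\#(\Lambda^{a}F/\mathcal O_K s)-\sum_{\sigma:K\to\mathbb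 C}\log\|s\|_\sigma,\] where $0\neq s\in\Lambda^{a}F$ is arbitrary and $\Lambda^{a}F$ has the exterior product metrics; if $\overline F\ne 0$, its slope is $\widehat\mu(\overline F)=\widehat{\deg}(\overline F)/(\delta_K a)$ and its minimal slope $\widehat\mu_{\min}(\overline F)$ is the minimum of the slopes of the non-zero quotient bundles of $F$ with the quotient metrics; $\widehat\mu_{\min}(0)=+\infty$. The slope filtration of $(E,g')$ is defined, for $t\in\mathbb R$, by \[\mathcal F^S_tE_K=\sum_{F\subset E,\ \widehat\mu_{\min}(\overline F)\ge t}F_K,\] where $F$ runs over the $\mathcal O_K$-submodules of $E$, with the metrics induced by $g'$. Then, for every $t\in\mathbb R$, \[\mathcal F^M_tE_K\subset\mathcal F^S_{t-\alpha}E_K,\qquad\text{where } \alpha=\log\sqrt r+D(E,g,g').\] -/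

import Mathlib

open scoped NumberField TensorProduct ComplexConjugate

noncomputable section

namespace Arakelov

/-! ### Hermitian forms: pull-back, quotient, exterior powers -/

section Forms

variable {𝕜 V W : Type*} [RCLike 𝕜] [AddCommGroup V] [Module 𝕜 V] [AddCommGroup W] [Module 𝕜 W]

/-- The norm `√⟨x, x⟩` of a positive definite Hermitian form. -/
def formNorm (c : InnerProductSpace.Core 𝕜 V) (x : V) : ℝ :=
  Real.sqrt (RCLike.re (c.inner x x))

/-- The form `⟨f x, f y⟩` induced on `V` by an injective linear map `f : V → W`. -/
@[reducible] def pullbackForm (c : InnerProductSpace.Core 𝕜 W) (f : V →ₗ[𝕜] W)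
    (hf : Function.Injective f) : InnerProductSpace.Core 𝕜 V where
  inner x y := c.inner (f x) (f y)
  conj_inner_symm x y := c.conj_inner_symm _ _
  re_inner_nonneg x := c.re_inner_nonneg _
  add_left x y z := by rw [map_add]; exact c.add_left _ _ _
  smul_left x y r := by rw [map_smul]; exact c.smul_left _ _ _
  definite x hx := hf (by rw [map_zero]; exact c.definite _ hx)

/-- The orthogonal complement of a subspace for a Hermitian form. -/
def orthCompl (c : InnerProductSpace.Core 𝕜 V) (N : Submodule 𝕜 V) : Submodule 𝕜 V :=
  letI := c.toNormedAddCommGroup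
  letI := InnerProductSpace.ofCore c.toCore
  Nᗮ

theorem mem_orthCompl (c : InnerProductSpace.Core 𝕜 V) (N : Submodule 𝕜 V) (x : V) :
    x ∈ orthCompl c N ↔ ∀ y ∈ N, c.inner y x = 0 := Iff.rfl

theorem isCompl_orthCompl [FiniteDimensional 𝕜 V] (c : InnerProductSpace.Core 𝕜 V)
    (N : Submodule 𝕜 V) : IsCompl N (orthCompl c N) := by
  let := c.toNormedAddCommGroup
  let := InnerProductSpace.ofCore c.toCore
  exact N.isCompl_orthogonal

/-- The linear section of a surjection `f` with values in the orthogonal complement of its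
kernel: it sends `w` to the preimage of `w` of smallest norm. -/
def orthSection [FiniteDimensional 𝕜 V] (c : InnerProductSpace.Core 𝕜 V) (f : V →ₗ[𝕜] W)
    (hf : Function.Surjective f) : W →ₗ[𝕜] V :=
  (orthCompl c (LinearMap.ker f)).subtype ∘ₗ
    (Submodule.quotientEquivOfIsCompl _ _ (isCompl_orthCompl c (LinearMap.ker f))).toLinearMap ∘ₗ
    (f.quotKerEquivOfSurjective hf).symm.toLinearMap

theorem orthSection_mem [FiniteDimensional 𝕜 V] (c : InnerProductSpace.Core 𝕜 V)
    (f : V →ₗ[𝕜] W) (hf : Function.Surjective f) (w : W) :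
    orthSection c f hf w ∈ orthCompl c (LinearMap.ker f) := Subtype.property _

theorem apply_orthSection [FiniteDimensional 𝕜 V] (c : InnerProductSpace.Core 𝕜 V)
    (f : V →ₗ[𝕜] W) (hf : Function.Surjective f) (w : W) : f (orthSection c f hf w) = w := by
  obtain ⟨q, rfl⟩ := (f.quotKerEquivOfSurjective hf).surjective w
  set e := Submodule.quotientEquivOfIsCompl _ _ (isCompl_orthCompl c (LinearMap.ker f)) with he
  obtain ⟨p, rfl⟩ := e.symm.surjective q
  have h : orthSection c f hf (f.quotKerEquivOfSurjective hf (e.symm p)) = p := by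
    simp [orthSection, ← he]
  rw [h]
  simp [he]

/-- The quotient form on `W` along a surjection `f : V → W`, i.e. the form making the orthogonal
complement of `ker f` isometric to `W`. -/
@[reducible] def quotientForm [FiniteDimensional 𝕜 V] (c : InnerProductSpace.Core 𝕜 V)
    (f : V →ₗ[𝕜] W) (hf : Function.Surjective f) : InnerProductSpace.Core 𝕜 W :=
  pullbackForm c (orthSection c f hf)
    (Function.LeftInverse.injective (g := f) (apply_orthSection c f hf))

/-- The linear map `x ↦ ⟨y, x⟩`. -/
def formRight (c : InnerProductSpace.Core 𝕜 V) (y : V) : V →ₗ[𝕜] 𝕜 :=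
  letI := c.toNormedAddCommGroup
  letI := InnerProductSpace.ofCore c.toCore
  innerₛₗ 𝕜 y

@[simp] theorem formRight_apply (c : InnerProductSpace.Core 𝕜 V) (y x : V) :
    formRight c y x = c.inner y x := rfl

/-- For fixed `y`, the alternating map `x ↦ det (⟨y i, x j⟩)`. -/
def gramAlt (c : InnerProductSpace.Core 𝕜 V) {n : ℕ} (y : Fin n → V) : V [⋀^Fin n]→ₗ[𝕜] 𝕜 :=
  Matrix.detRowAlternating.compLinearMap (LinearMap.pi fun i => formRight c (y i))

theorem gramAlt_apply (c : InnerProductSpace.Core 𝕜 V) {n : ℕ} (y x : Fin n → V) :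
    gramAlt c y x = (Matrix.of fun i j => c.inner (y i) (x j)).det := by
  rw [← Matrix.det_transpose]; rfl

theorem gramAlt_conj (c : InnerProductSpace.Core 𝕜 V) {n : ℕ} (y x : Fin n → V) :
    conj (gramAlt c y x) = gramAlt c x y := by
  rw [gramAlt_apply, gramAlt_apply, ← Matrix.det_transpose, RingHom.map_det]
  congr 1
  ext i j
  exact c.conj_inner_symm _ _

/-- For fixed `w` in the `n`-th exterior power, the alternating map sending `y` to
`⟨w, y 0 ∧ … ∧ y (n - 1)⟩`. -/
def extAlt (c : InnerProductSpace.Core 𝕜 V) {n : ℕ} (w : ⋀[𝕜]^n V) : V [⋀^Fin n]→ₗ[𝕜] 𝕜 where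
  toFun y := conj (exteriorPower.alternatingMapLinearEquiv (gramAlt c y) w)
  map_update_add' {d} y i a b := by
    have h : d = instDecidableEqFin n := Subsingleton.elim _ _
    subst h
    have : gramAlt c (Function.update y i (a + b)) =
        gramAlt c (Function.update y i a) + gramAlt c (Function.update y i b) := by
      ext x
      rw [AlternatingMap.add_apply, ← gramAlt_conj c x, ← gramAlt_conj c x, ← gramAlt_conj c x,
        AlternatingMap.map_update_add, map_add]
    rw [this, map_add, LinearMap.add_apply, map_add]
  map_update_smul' {d} y i r a := by
    have h : d = instDecidableEqFin n := Subsingleton.elim _ _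
    subst h
    have : gramAlt c (Function.update y i (r • a)) =
        conj r • gramAlt c (Function.update y i a) := by
      ext x
      rw [AlternatingMap.smul_apply, ← gramAlt_conj c x, ← gramAlt_conj c x,
        AlternatingMap.map_update_smul, smul_eq_mul, map_mul, smul_eq_mul]
    rw [this, map_smul, LinearMap.smul_apply, smul_eq_mul, map_mul, RCLike.conj_conj, smul_eq_mul]
  map_eq_zero_of_eq' y i j hy hij := by
    have : gramAlt c y = 0 := by
      ext x
      rw [← gramAlt_conj c x, AlternatingMap.map_eq_zero_of_eq _ _ hy hij, map_zero]
      rfl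
    rw [this, map_zero, LinearMap.zero_apply, map_zero]

/-- The exterior product form on the `n`-th exterior power, characterised by
`⟨x 1 ∧ … ∧ x n, y 1 ∧ … ∧ y n⟩ = det (⟨x i, y j⟩)`. -/
def extForm (c : InnerProductSpace.Core 𝕜 V) {n : ℕ} (w z : ⋀[𝕜]^n V) : 𝕜 :=
  exteriorPower.alternatingMapLinearEquiv (extAlt c w) z

theorem extForm_ιMulti (c : InnerProductSpace.Core 𝕜 V) {n : ℕ} (x y : Fin n → V) :
    extForm c (exteriorPower.ιMulti 𝕜 n x) (exteriorPower.ιMulti 𝕜 n y) =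
      (Matrix.of fun i j => c.inner (x i) (y j)).det := by
  rw [extForm, exteriorPower.alternatingMapLinearEquiv_apply_ιMulti, ← gramAlt_apply,
    ← gramAlt_conj c y x]
  change conj (exteriorPower.alternatingMapLinearEquiv (gramAlt c y) _) = _
  rw [exteriorPower.alternatingMapLinearEquiv_apply_ιMulti]

/-- The exterior product norm on the `n`-th exterior power. -/
def extNorm (c : InnerProductSpace.Core 𝕜 V) {n : ℕ} (w : ⋀[𝕜]^n V) : ℝ :=
  Real.sqrt (RCLike.re (extForm c w w))

end Forms

/-! ### Complex embeddings and complex fibres -/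

section Fibres

variable {K : Type*} [Field K]

/-- The field `ℂ`, seen as an algebra over `K` through the embedding `σ`. -/
def CEmb (_σ : K →+* ℂ) : Type := ℂ

instance (σ : K →+* ℂ) : Field (CEmb σ) := inferInstanceAs (Field ℂ)

instance (σ : K →+* ℂ) : Algebra K (CEmb σ) := RingHom.toAlgebra (S := ℂ) σ

instance (σ : K →+* ℂ) : Algebra ℂ (CEmb σ) := inferInstanceAs (Algebra ℂ ℂ)

instance (σ : K →+* ℂ) : Module.Finite ℂ (CEmb σ) := inferInstanceAs (Module.Finite ℂ ℂ)

instance (σ : K →+* ℂ) : SMulCommClass (𝓞 K) ℂ (CEmb σ) where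
  smul_comm a z w := mul_left_comm (G := ℂ) (σ (algebraMap (𝓞 K) K a)) z w

instance (σ : K →+* ℂ) : Module.IsTorsionFree (𝓞 K) (CEmb σ) :=
  Module.IsTorsionFree.trans_faithfulSMul (𝓞 K) K (CEmb σ)

variable (E : Type*) [AddCommGroup E] [Module (𝓞 K) E]

/-- The complex vector space `E_σ = ℂ ⊗ E`, the tensor product being taken over `𝓞 K` through
the embedding `σ`. -/
abbrev Fibre (σ : K →+* ℂ) : Type _ := CEmb σ ⊗[𝓞 K] E

/-- The image `1 ⊗ s` in `E_σ` of an element `s` of `E`. -/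
def toFibre (σ : K →+* ℂ) : E →ₗ[𝓞 K] Fibre E σ := TensorProduct.mk (𝓞 K) (CEmb σ) E 1

/-- The `ℂ`-linear map `id ⊗ f : E_σ → F_σ` induced by a linear map `f : E → F`. -/
def fibreMap {E F : Type*} [AddCommGroup E] [Module (𝓞 K) E] [AddCommGroup F] [Module (𝓞 K) F]
    (σ : K →+* ℂ) (f : E →ₗ[𝓞 K] F) : Fibre E σ →ₗ[ℂ] Fibre F σ where
  toFun := f.lTensor (CEmb σ)
  map_add' := map_add _
  map_smul' r x := by
    induction x using TensorProduct.induction_on with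
    | zero => simp
    | tmul z s => simp [TensorProduct.smul_tmul']
    | add x y hx hy => rw [smul_add, map_add, hx, hy, ← smul_add, ← map_add]

theorem toFibre_smul (σ : K →+* ℂ) (r : 𝓞 K) (s : E) :
    toFibre E σ (r • s) = σ (algebraMap (𝓞 K) K r) • toFibre E σ s := by
  rw [map_smul]
  change (r • (1 : CEmb σ)) ⊗ₜ[𝓞 K] s = (σ (algebraMap (𝓞 K) K r) • (1 : CEmb σ)) ⊗ₜ[𝓞 K] s
  rfl

/-- Complex conjugation, as a map from `ℂ` (embedding `σ`) to `ℂ` (conjugate embedding). -/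
def conjEmb (σ : K →+* ℂ) : CEmb σ →ₗ[𝓞 K] CEmb (NumberField.ComplexEmbedding.conjugate σ) where
  toFun := (starRingEnd ℂ : ℂ → ℂ)
  map_add' := (starRingEnd ℂ).map_add
  map_smul' a := (starRingEnd ℂ).map_mul (σ (algebraMap (𝓞 K) K a))

/-- Complex conjugation `z ⊗ s ↦ conj z ⊗ s` from the fibre of `E` at `σ` to the fibre at the
conjugate embedding. -/
def conjFibre (σ : K →+* ℂ) :
    Fibre E σ →ₗ[𝓞 K] Fibre E (NumberField.ComplexEmbedding.conjugate σ) :=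
  LinearMap.rTensor E (conjEmb σ)

variable (K)

/-- Metrics of a metrized vector bundle with underlying module `E`: a norm on each `E_σ`, the
family being invariant by complex conjugation. -/
structure Metric where
  norm : ∀ σ : K →+* ℂ, Seminorm ℂ (Fibre E σ)
  eq_zero_of_norm : ∀ (σ : K →+* ℂ) (x : Fibre E σ), norm σ x = 0 → x = 0
  norm_conj : ∀ (σ : K →+* ℂ) (x : Fibre E σ),
    norm (NumberField.ComplexEmbedding.conjugate σ) (conjFibre E σ x) = norm σ x

/-- A family of positive definite Hermitian forms on the fibres `E_σ`. -/
abbrev HermitianForms : Type _ := ∀ σ : K →+* ℂ, InnerProductSpace.Core ℂ (Fibre E σ)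

/-- Metrics of a Hermitian vector bundle with underlying module `E`: a Hermitian norm on each
`E_σ`, the family being invariant by complex conjugation. -/
structure HermitianMetric where
  form : HermitianForms K E
  norm_conj : ∀ (σ : K →+* ℂ) (x : Fibre E σ),
    formNorm (form (NumberField.ComplexEmbedding.conjugate σ)) (conjFibre E σ x) =
      formNorm (form σ) x

variable {K E}

/-- The metrized vector bundle underlying a Hermitian vector bundle. -/
def HermitianMetric.toMetric (g : HermitianMetric K E) : Metric K E where
  norm σ :=
    letI := (g.form σ).toNormedAddCommGroup
    letI := InnerProductSpace.ofCore (g.form σ).toCore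
    normSeminorm ℂ (Fibre E σ)
  eq_zero_of_norm σ x hx := by
    let := (g.form σ).toNormedAddCommGroup
    let := InnerProductSpace.ofCore (g.form σ).toCore
    exact norm_eq_zero.mp hx
  norm_conj := g.norm_conj

theorem HermitianMetric.toMetric_norm (g : HermitianMetric K E) (σ : K →+* ℂ) (x : Fibre E σ) :
    g.toMetric.norm σ x = formNorm (g.form σ) x := rfl

/-- The distance `D(E, g, g')` between two families of norms. -/
def metricDist (g g' : Metric K E) : ℝ :=
  ⨆ σ : K →+* ℂ, ⨆ s : {s : Fibre E σ // s ≠ 0},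
    |Real.log (g.norm σ s) - Real.log (g'.norm σ s)|

/-- The set `𝔹(E, a)` of elements of `E` all of whose norms are at most `a`. -/
def smallSections (g : Metric K E) (a : ℝ) : Set E :=
  {s | ∀ σ : K →+* ℂ, g.norm σ (toFibre E σ s) ≤ a}

/-- The minimum filtration of a metrized vector bundle: the subspace of `E_K` generated by the
elements of `E` all of whose norms are at most `exp (-t)`. -/
def minimumFiltration (g : Metric K E) (t : ℝ) : Submodule K (K ⊗[𝓞 K] E) :=
  Submodule.span K ((fun s : E => (1 : K) ⊗ₜ[𝓞 K] s) '' smallSections g (Real.exp (-t)))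

end Fibres

/-! ### Arakelov degree, slopes and the slope filtration -/

section Slopes

variable {K : Type*} [Field K] {E : Type*} [AddCommGroup E] [Module (𝓞 K) E]

/-- The ring homomorphism `𝓞 K → ℂ` underlying `σ`. -/
abbrev intEmb (σ : K →+* ℂ) : 𝓞 K →+* ℂ := σ.comp (algebraMap (𝓞 K) K)

/-- The alternating map `x ↦ (1 ⊗ x 0) ∧ … ∧ (1 ⊗ x (n - 1))`, where `𝓞 K` acts on the target
through `σ`. -/
def wedgeToFibre (σ : K →+* ℂ) (n : ℕ) :
    letI : Module (𝓞 K) (⋀[ℂ]^n (Fibre E σ)) := Module.compHom _ (intEmb σ)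
    E [⋀^Fin n]→ₗ[𝓞 K] ⋀[ℂ]^n (Fibre E σ) :=
  letI : Module (𝓞 K) (⋀[ℂ]^n (Fibre E σ)) := Module.compHom _ (intEmb σ)
  have h {d : DecidableEq (Fin n)} (x : Fin n → E) (i : Fin n) (v : E) :
      (fun j => toFibre E σ (Function.update x i v j)) =
        Function.update (fun j => toFibre E σ (x j)) i (toFibre E σ v) := by
    ext j; by_cases hj : j = i
    · subst hj; simp
    · simp [hj]
  { toFun := fun x => exteriorPower.ιMulti ℂ n (fun i => toFibre E σ (x i))
    map_update_add' := fun x i a b => by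
      simp only [h, map_add, AlternatingMap.map_update_add]
    map_update_smul' := fun x i r a => by
      simp only [h, toFibre_smul, AlternatingMap.map_update_smul]
      rfl
    map_eq_zero_of_eq' := fun x i j hx hij =>
      AlternatingMap.map_eq_zero_of_eq _ _ (by simp only [hx]) hij }

/-- The canonical map from the exterior power of `E` to the exterior power of the fibre `E_σ`. -/
def extToFibre (σ : K →+* ℂ) (n : ℕ) : ⋀[𝓞 K]^n E →ₛₗ[intEmb σ] ⋀[ℂ]^n (Fibre E σ) :=
  letI : Module (𝓞 K) (⋀[ℂ]^n (Fibre E σ)) := Module.compHom _ (intEmb σ)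
  { toFun := exteriorPower.alternatingMapLinearEquiv (wedgeToFibre σ n)
    map_add' := map_add _
    map_smul' := fun r x => map_smul _ r x }

theorem extToFibre_ιMulti (σ : K →+* ℂ) (n : ℕ) (x : Fin n → E) :
    extToFibre σ n (exteriorPower.ιMulti (𝓞 K) n x) =
      exteriorPower.ιMulti ℂ n (fun i => toFibre E σ (x i)) :=
  letI : Module (𝓞 K) (⋀[ℂ]^n (Fibre E σ)) := Module.compHom _ (intEmb σ)
  exteriorPower.alternatingMapLinearEquiv_apply_ιMulti (wedgeToFibre σ n) x

open Classical in
/-- The Arakelov degree of the Hermitian vector bundle `(E, h)`, that is, of the Hermitian line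
bundle `L = Λ^r E`, where `r` is the rank of `E` and `L` has the exterior product metrics:
`log #(L / (𝓞 K) s) - ∑ σ, log ‖s‖_σ` for some nonzero `s` in `L` (all choices of `s` give the
same value, by the product formula). -/
def arakelovDegree [NumberField K] (h : HermitianForms K E) : ℝ :=
  if hs : ∃ s : ⋀[𝓞 K]^(Module.finrank (𝓞 K) E) E, s ≠ 0 then
    Real.log (Nat.card ((⋀[𝓞 K]^(Module.finrank (𝓞 K) E) E) ⧸ Submodule.span (𝓞 K) {hs.choose})) -
      ∑ σ : K →+* ℂ, Real.log (extNorm (h σ) (extToFibre σ _ hs.choose))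
  else 0

/-- The slope of a Hermitian vector bundle. -/
def slope [NumberField K] (h : HermitianForms K E) : ℝ :=
  arakelovDegree h / (Module.finrank ℚ K * Module.finrank (𝓞 K) E)

theorem fibreMap_subtype_injective [NumberField K] (σ : K →+* ℂ) (F : Submodule (𝓞 K) E) :
    Function.Injective (fibreMap σ F.subtype) :=
  Module.Flat.lTensor_preserves_injective_linearMap (M := CEmb σ) F.subtype F.injective_subtype

theorem fibreMap_mkQ_surjective (σ : K →+* ℂ) (N : Submodule (𝓞 K) E) :
    Function.Surjective (fibreMap σ N.mkQ) :=
  LinearMap.lTensor_surjective (CEmb σ) N.mkQ_surjective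

instance [Module.Finite (𝓞 K) E] (σ : K →+* ℂ) : FiniteDimensional ℂ (Fibre E σ) :=
  Module.Finite.trans (CEmb σ) (Fibre E σ)

/-- The metrics induced on a submodule. -/
@[reducible] def subForms [NumberField K] (h : HermitianForms K E) (F : Submodule (𝓞 K) E) : HermitianForms K F := fun σ =>
  pullbackForm (h σ) (fibreMap σ F.subtype) (fibreMap_subtype_injective σ F)

/-- The quotient metrics on a quotient module. -/
@[reducible] def quotientForms [Module.Finite (𝓞 K) E] (h : HermitianForms K E) (N : Submodule (𝓞 K) E) :
    HermitianForms K (E ⧸ N) := fun σ =>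
  quotientForm (h σ) (fibreMap σ N.mkQ) (fibreMap_mkQ_surjective σ N)

/-- The minimal slope: the minimum of the slopes of all nonzero quotient bundles (that is, nonzero
projective quotient modules with the quotient metrics). It is `⊤` when `E = 0`. -/
def minSlope [NumberField K] [Module.Finite (𝓞 K) E] (h : HermitianForms K E) : EReal :=
  ⨅ (N : Submodule (𝓞 K) E) (_ : N ≠ ⊤) (_ : Module.Projective (𝓞 K) (E ⧸ N)),
    ((slope (quotientForms h N) : ℝ) : EReal)

/-- The slope filtration of a Hermitian vector bundle: the sum of the subspaces `F_K` of `E_K`,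
where `F` runs over the subbundles of `E` with minimal slope at least `t`. -/
def slopeFiltration [NumberField K] [Module.Finite (𝓞 K) E] (g : HermitianMetric K E) (t : ℝ) :
    Submodule K (K ⊗[𝓞 K] E) :=
  ⨆ (F : Submodule (𝓞 K) E) (_ : (t : EReal) ≤ minSlope (subForms g.form F)), F.baseChange K

end Slopes

end Arakelov

end

/-!
The small sections of `E` span an `𝓞 K`-submodule `F`, and it suffices to bound the minimal slope
of `F`. Let `Q` be a nonzero projective quotient of `F`, of rank `a`. It is generated by the images
of the small sections, so `a` of these images are linearly independent
(`exists_linearIndependent_fin_finrank`). Their wedge product `w` is a nonzero section of `Λ^a Q`.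
Since the degree does not depend on the section used to compute it, and
`#(Λ^a Q / 𝓞 K w) ≥ 1`, the degree of `Q` is at least `-∑ σ, log ‖w‖_σ`
(`neg_sum_log_extNorm_le_arakelovDegree`). This independence is the product formula: both the
index of the ideal `(x)` and the product of the absolute values `|σ x|` equal the absolute value of
the norm of `x`, and any two
nonzero sections of `Λ^a Q` have a common nonzero multiple (`pow_smul_mem_span_ιMulti`).

Finally `‖w‖_σ ^ 2` is the Gram determinant of the chosen images. Their Hermitian norms are at most
`exp (D - t)`, as quotient maps do not increase norms and `D` bounds the logarithm of the ratio of
the two metrics (a finite supremum, by equivalence of norms in finite dimension). The inequality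
of arithmetic and geometric means for the eigenvalues of the Gram matrix then gives
`‖w‖_σ ≤ exp (a (D - t))`, so that every slope is at least `t - D ≥ t - α`. The term `log √r` of
`α` only enters through its nonnegativity, because the Gram determinant is bounded without any
loss depending on the rank.
-/

noncomputable section

namespace Arakelov

/-! ### Exterior and quotient norms -/

section Forms

variable {𝕜 V W : Type*} [RCLike 𝕜] [AddCommGroup V] [Module 𝕜 V] [AddCommGroup W] [Module 𝕜 W]

theorem extForm_smul_smul (c : InnerProductSpace.Core 𝕜 V) {n : ℕ} (r : 𝕜) (w : ⋀[𝕜]^n V) :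
    extForm c (r • w) (r • w) = conj r * r * extForm c w w := by
  have h : extAlt c (r • w) = conj r • extAlt c w := by
    ext y
    change conj (exteriorPower.alternatingMapLinearEquiv (gramAlt c y) (r • w)) =
      conj r • conj (exteriorPower.alternatingMapLinearEquiv (gramAlt c y) w)
    rw [map_smul, smul_eq_mul, map_mul, smul_eq_mul]
  rw [extForm, h, map_smul, map_smul, LinearMap.smul_apply, smul_eq_mul, smul_eq_mul, ← mul_assoc,
    mul_comm r]
  rfl

theorem extNorm_smul (c : InnerProductSpace.Core 𝕜 V) {n : ℕ} (r : 𝕜) (w : ⋀[𝕜]^n V) :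
    extNorm c (r • w) = ‖r‖ * extNorm c w := by
  rw [extNorm, extForm_smul_smul, RCLike.conj_mul, ← RCLike.ofReal_pow, RCLike.re_ofReal_mul,
    Real.sqrt_mul (sq_nonneg _), Real.sqrt_sq (norm_nonneg _), extNorm]

open scoped ComplexOrder in
theorem extNorm_ιMulti_pos (c : InnerProductSpace.Core 𝕜 V) {n : ℕ} {x : Fin n → V}
    (hx : LinearIndependent 𝕜 x) : 0 < extNorm c (exteriorPower.ιMulti 𝕜 n x) := by
  let := c.toNormedAddCommGroup
  let := InnerProductSpace.ofCore c.toCore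
  have h := (RCLike.pos_iff.mp (Matrix.posDef_gram_of_linearIndependent hx).det_pos).1
  rw [extNorm, extForm_ιMulti]
  exact Real.sqrt_pos.mpr h

open scoped ComplexOrder in
/-- A positive semidefinite matrix whose diagonal entries are at most `b` has determinant at
most `b ^ n`, by the inequality of arithmetic and geometric means for its eigenvalues. -/
theorem _root_.Matrix.PosSemidef.re_det_le_pow {n : ℕ} {A : Matrix (Fin n) (Fin n) 𝕜}
    (hA : A.PosSemidef) {b : ℝ} (hb : ∀ i, RCLike.re (A i i) ≤ b) : RCLike.re A.det ≤ b ^ n := by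
  rcases Nat.eq_zero_or_pos n with rfl | hn
  · simp
  have hn' : (0 : ℝ) < n := Nat.cast_pos.mpr hn
  have htr : ∑ i, hA.1.eigenvalues i ≤ n * b := by
    have h := congrArg RCLike.re hA.1.trace_eq_sum_eigenvalues
    rw [← RCLike.ofReal_sum, RCLike.ofReal_re, Matrix.trace, map_sum] at h
    rw [← h]
    simpa using Finset.sum_le_sum fun i (_ : i ∈ Finset.univ) => hb i
  have hamgm := Real.geom_mean_le_arith_mean Finset.univ (fun _ => (1 : ℝ)) hA.1.eigenvalues
    (fun _ _ => zero_le_one) (by simpa using hn) fun i _ => hA.eigenvalues_nonneg i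
  simp only [Real.rpow_one, one_mul, Finset.sum_const, Finset.card_univ, Fintype.card_fin,
    nsmul_eq_mul, mul_one] at hamgm
  have hprod : 0 ≤ ∏ i, hA.1.eigenvalues i := Finset.prod_nonneg fun i _ => hA.eigenvalues_nonneg i
  rw [hA.1.det_eq_prod_eigenvalues, ← RCLike.ofReal_prod, RCLike.ofReal_re,
    ← Real.rpow_inv_natCast_pow hprod hn.ne']
  exact pow_le_pow_left₀ (Real.rpow_nonneg hprod _)
    (hamgm.trans ((div_le_iff₀' hn').mpr htr)) n

theorem extNorm_ιMulti_le_pow (c : InnerProductSpace.Core 𝕜 V) {n : ℕ} {x : Fin n → V} {b : ℝ}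
    (hb : 0 ≤ b) (hx : ∀ i, formNorm c (x i) ≤ b) :
    extNorm c (exteriorPower.ιMulti 𝕜 n x) ≤ b ^ n := by
  have h : RCLike.re (Matrix.of fun i j => c.inner (x i) (x j)).det ≤ (b ^ 2) ^ n := by
    let := c.toNormedAddCommGroup
    let := InnerProductSpace.ofCore c.toCore
    refine (Matrix.posSemidef_gram 𝕜 x).re_det_le_pow fun i => ?_
    exact (Real.sqrt_le_left hb).mp (hx i)
  rw [extNorm, extForm_ιMulti, Real.sqrt_le_left (pow_nonneg hb n), ← pow_mul, mul_comm n 2,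
    pow_mul]
  exact h

theorem formNorm_quotientForm_le [FiniteDimensional 𝕜 V] (c : InnerProductSpace.Core 𝕜 V)
    (f : V →ₗ[𝕜] W) (hf : Function.Surjective f) (v : V) :
    formNorm (quotientForm c f hf) (f v) ≤ formNorm c v := by
  have hk : v - orthSection c f hf (f v) ∈ LinearMap.ker f := by
    rw [LinearMap.mem_ker, map_sub, apply_orthSection, sub_self]
  have ho := (mem_orthCompl c _ _).mp (orthSection_mem c f hf (f v)) _ hk
  let := c.toNormedAddCommGroup
  let := InnerProductSpace.ofCore c.toCore
  set p := orthSection c f hf (f v) with hp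
  -- Pythagoras for the decomposition of `v` along `ker f` and its orthogonal complement
  have h := norm_add_sq_eq_norm_sq_add_norm_sq_of_inner_eq_zero (𝕜 := 𝕜) (v - p) p ho
  rw [sub_add_cancel] at h
  change ‖p‖ ≤ ‖v‖
  nlinarith [norm_nonneg p, norm_nonneg v, mul_self_nonneg ‖v - p‖]

end Forms

/-! ### Comparison of norms -/

/-- The finite-dimensional space is normed by `q`; boundedness of the coordinate functionals then
bounds `p`. -/
theorem _root_.Seminorm.exists_le_mul {V : Type*} [AddCommGroup V] [Module ℂ V]
    [FiniteDimensional ℂ V] (p q : Seminorm ℂ V) (hq : ∀ x, q x = 0 → x = 0) :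
    ∃ C : ℝ, ∀ x, p x ≤ C * q x := by
  let : NormedAddCommGroup V := AddGroupNorm.toNormedAddCommGroup
    { q.toAddGroupSeminorm with eq_zero_of_map_eq_zero' := hq }
  let : NormedSpace ℂ V := ⟨fun a x => (map_smul_eq_mul q a x).le⟩
  let b := Module.finBasis ℂ V
  refine ⟨∑ i, ‖LinearMap.toContinuousLinearMap (b.coord i)‖ * p (b i), fun x => ?_⟩
  calc p x = p (∑ i, b.coord i x • b i) := by simp [b.sum_repr]
    _ ≤ ∑ i, p (b.coord i x • b i) :=
      Finset.le_sum_of_subadditive p (map_zero p).le (map_add_le_add p) _ _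
    _ ≤ ∑ i, ‖LinearMap.toContinuousLinearMap (b.coord i)‖ * p (b i) * q x := by
      refine Finset.sum_le_sum fun i _ => ?_
      rw [map_smul_eq_mul, mul_right_comm]
      exact mul_le_mul_of_nonneg_right
        ((LinearMap.toContinuousLinearMap (b.coord i)).le_opNorm x) (apply_nonneg p _)
    _ = _ := (Finset.sum_mul ..).symm

theorem _root_.Seminorm.bddAbove_abs_log_sub_log {V : Type*} [AddCommGroup V] [Module ℂ V]
    [FiniteDimensional ℂ V] (p q : Seminorm ℂ V) (hp : ∀ x, p x = 0 → x = 0)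
    (hq : ∀ x, q x = 0 → x = 0) :
    BddAbove (Set.range fun s : {s : V // s ≠ 0} => |Real.log (p s) - Real.log (q s)|) := by
  -- if `p ≤ C q`, the logarithms differ by at most `log C`
  have key (p q : Seminorm ℂ V) (hp : ∀ x, p x = 0 → x = 0) (hq : ∀ x, q x = 0 → x = 0) :
      ∃ B : ℝ, ∀ x, x ≠ 0 → Real.log (p x) - Real.log (q x) ≤ B := by
    obtain ⟨C, hC⟩ := p.exists_le_mul q hq
    refine ⟨Real.log C, fun x hx => ?_⟩
    have hpx : 0 < p x := (apply_nonneg p x).lt_of_ne' fun h => hx (hp x h)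
    have hqx : 0 < q x := (apply_nonneg q x).lt_of_ne' fun h => hx (hq x h)
    have hC0 : 0 < C := pos_of_mul_pos_left (hpx.trans_le (hC x)) hqx.le
    rw [sub_le_iff_le_add, ← Real.log_mul hC0.ne' hqx.ne']
    exact Real.log_le_log hpx (hC x)
  obtain ⟨B, hB⟩ := key p q hp hq
  obtain ⟨B', hB'⟩ := key q p hq hp
  refine ⟨max B B', ?_⟩
  rintro _ ⟨⟨x, hx⟩, rfl⟩
  refine abs_le.mpr ⟨?_, (hB x hx).trans (le_max_left _ _)⟩
  linarith [hB' x hx, le_max_right B B']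

/-- The suprema defining `metricDist` are finite, hence they bound the ratio of the norms. -/
theorem norm_le_exp_metricDist_mul {K E : Type*} [Field K] [NumberField K] [AddCommGroup E]
    [Module (𝓞 K) E] [Module.Finite (𝓞 K) E] (g g' : Metric K E) (σ : K →+* ℂ) (x : Fibre E σ) :
    g'.norm σ x ≤ Real.exp (metricDist g g') * g.norm σ x := by
  rcases eq_or_ne x 0 with rfl | hx
  · simp
  have hpos (g : Metric K E) : 0 < g.norm σ x :=
    (apply_nonneg _ x).lt_of_ne' fun h => hx (g.eq_zero_of_norm σ x h)
  have h : |Real.log (g.norm σ x) - Real.log (g'.norm σ x)| ≤ metricDist g g' :=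
    (le_ciSup ((g.norm σ).bddAbove_abs_log_sub_log (g'.norm σ) (g.eq_zero_of_norm σ)
      (g'.eq_zero_of_norm σ)) ⟨x, hx⟩).trans
      (le_ciSup (f := fun σ => ⨆ s : {s : Fibre E σ // s ≠ 0},
        |Real.log (g.norm σ s) - Real.log (g'.norm σ s)|) (Set.finite_range _).bddAbove σ)
  rw [← Real.log_le_log_iff (hpos g') (mul_pos (Real.exp_pos _) (hpos g)),
    Real.log_mul (Real.exp_pos _).ne' (hpos g).ne', Real.log_exp]
  linarith [(abs_le.mp h).1]

/-! ### Exterior powers and maximal independent families -/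

section Algebra

variable {R M : Type*} [CommRing R] [AddCommGroup M] [Module R M]

theorem projective_exteriorPower [Module.Projective R M] (n : ℕ) :
    Module.Projective R (⋀[R]^n M) := by
  obtain ⟨s, hs⟩ := Module.projective_def'.mp ‹Module.Projective R M›
  refine Module.Projective.of_split (exteriorPower.map n s)
    (exteriorPower.map n (Finsupp.linearCombination R id)) ?_
  rw [← exteriorPower.map_comp, hs, exteriorPower.map_id]

theorem exists_smul_mem_of_isTorsion_quotient [IsDomain R] [Module.Finite R M]
    {N : Submodule R M} (h : Module.IsTorsion R (M ⧸ N)) :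
    ∃ m : R, m ≠ 0 ∧ ∀ x : M, m • x ∈ N := by
  obtain ⟨m, hm, hm0⟩ := Submodule.annihilator_top_inter_nonZeroDivisors h
  refine ⟨m, nonZeroDivisors.ne_zero hm0, fun x => ?_⟩
  rw [← Submodule.Quotient.mk_eq_zero, Submodule.Quotient.mk_smul]
  exact Submodule.mem_annihilator.mp hm _ trivial

/-- If `m • M` lies in the free module spanned by `v`, then `m ^ n` maps the `n`-th exterior power
into the line generated by the wedge product of `v`. -/
theorem pow_smul_mem_span_ιMulti {n : ℕ} {v : Fin n → M} (hv : LinearIndependent R v) {m : R}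
    (hm : ∀ x : M, m • x ∈ Submodule.span R (Set.range v)) (z : ⋀[R]^n M) :
    m ^ n • z ∈ Submodule.span R {exteriorPower.ιMulti R n v} := by
  let b := Module.Basis.span hv
  let N := Submodule.span R (Set.range v)
  have hb (i : Fin n) : (b i : M) = v i :=
    congrArg Subtype.val (Module.Basis.span_apply hv i)
  -- by uniqueness of alternating forms on the free module spanned by `v`, its wedge product is
  -- the determinant times the wedge product of `v`
  have hdet : (exteriorPower.ιMulti R n).compLinearMap N.subtype =
      (LinearMap.toSpanSingleton R _ (exteriorPower.ιMulti R n v)).compAlternatingMap b.det := by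
    refine Module.Basis.ext_alternating b fun e he => ?_
    let τ := Equiv.ofBijective e (Finite.injective_iff_bijective.mp he)
    have h1 : b.det (fun i => b (e i)) = Equiv.Perm.sign τ • b.det b := b.det.map_perm b τ
    have h2 : exteriorPower.ιMulti R n (fun i => v (e i)) =
      Equiv.Perm.sign τ • exteriorPower.ιMulti R n v := (exteriorPower.ιMulti R n).map_perm v τ
    have h3 : ((exteriorPower.ιMulti R n).compLinearMap N.subtype fun i => b (e i)) =
        exteriorPower.ιMulti R n (fun i => v (e i)) := by
      simp only [AlternatingMap.compLinearMap_apply, Submodule.subtype_apply, hb]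
    rw [h3, h2, LinearMap.compAlternatingMap_apply, h1, b.det_self,
      LinearMap.toSpanSingleton_apply]
    simp [Units.smul_def, ← Int.cast_smul_eq_zsmul R]
  have hz : z ∈ Submodule.span R (Set.range (exteriorPower.ιMulti R n (M := M))) := by
    rw [exteriorPower.ιMulti_span]; trivial
  induction hz using Submodule.span_induction with
  | mem z hz =>
    obtain ⟨x, rfl⟩ := hz
    have h1 := (exteriorPower.ιMulti R n).map_smul_univ (fun _ => m) x
    rw [Finset.prod_const, Finset.card_univ, Fintype.card_fin] at h1
    have h2 := DFunLike.congr_fun hdet fun i => ⟨m • x i, hm (x i)⟩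
    rw [← h1]
    refine Submodule.mem_span_singleton.mpr ⟨_, h2.symm⟩
  | zero => simp
  | add x y _ _ hx hy => rw [smul_add]; exact add_mem hx hy
  | smul r x _ hx => rw [smul_comm]; exact Submodule.smul_mem _ _ hx

theorem isTorsion_quotient_span_of_linearIndependent [IsDomain R] [Module.Finite R M]
    {v : Fin (Module.finrank R M) → M} (hv : LinearIndependent R v) :
    Module.IsTorsion R (M ⧸ Submodule.span R (Set.range v)) := by
  rw [← Module.finrank_eq_zero_iff_isTorsion]
  have h := Submodule.finrank_quotient_add_finrank (Submodule.span R (Set.range v))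
  rw [finrank_span_eq_card hv, Fintype.card_fin] at h
  omega

/-- A generating set of a finite module over a domain contains a maximal linearly independent
family whose cardinality is the rank. -/
theorem exists_linearIndependent_fin_finrank [IsDomain R] [Module.Finite R M] {S : Set M}
    (hS : Submodule.span R S = ⊤) :
    ∃ v : Fin (Module.finrank R M) → M, LinearIndependent R v ∧ ∀ i, v i ∈ S := by
  obtain ⟨I, hI, hmax⟩ := exists_maximal_linearIndepOn R (Subtype.val : S → M)
  have htors : Module.IsTorsion R (M ⧸ Submodule.span R (Subtype.val '' I)) := by
    have h : Submodule.span R S ≤ (Submodule.torsion R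
        (M ⧸ Submodule.span R (Subtype.val '' I))).comap (Submodule.mkQ _) := by
      rw [Submodule.span_le]
      intro s hs
      by_cases hsI : ⟨s, hs⟩ ∈ I
      · exact ⟨1, (Submodule.Quotient.mk_eq_zero _).mpr
          (Submodule.smul_mem _ 1 (Submodule.subset_span ⟨_, hsI, rfl⟩))⟩
      · obtain ⟨a, ha, has⟩ := hmax ⟨s, hs⟩ hsI
        refine ⟨⟨a, mem_nonZeroDivisors_of_ne_zero ha⟩, ?_⟩
        exact (Submodule.Quotient.mk_eq_zero _).mpr has
    intro x
    obtain ⟨y, rfl⟩ := Submodule.mkQ_surjective _ x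
    exact h (hS ▸ Submodule.mem_top)
  have hfin : Finite I := hI.linearIndependent.finite
  have hcard : Nat.card I = Module.finrank R M := by
    have := Fintype.ofFinite I
    have h := Submodule.finrank_quotient_add_finrank (Submodule.span R (Subtype.val '' I))
    rw [Module.finrank_eq_zero_iff_isTorsion.mpr htors, zero_add, Set.image_eq_range,
      finrank_span_eq_card hI.linearIndependent] at h
    rw [Nat.card_eq_fintype_card, h]
  let e := (Finite.equivFinOfCardEq hcard).symm
  exact ⟨fun i => (e i : S), hI.linearIndependent.comp e e.injective, fun i => (e i : S).2⟩

end Algebra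

/-! ### Arakelov degree and wedge products -/

section Degree

variable {K : Type*} [Field K] [NumberField K]

theorem sum_log_norm_embeddings {x : 𝓞 K} (hx : x ≠ 0) :
    ∑ σ : K →+* ℂ, Real.log ‖σ x‖ = Real.log (Ideal.absNorm (Ideal.span {x})) := by
  rw [← Real.log_prod fun σ _ => by simpa using hx]
  congr 1
  have h := congrArg (‖·‖) (Algebra.norm_eq_prod_embeddings ℚ ℂ (x : K))
  simp only [norm_prod] at h
  rw [← Fintype.prod_equiv (RingHom.equivRatAlgHom K ℂ) (fun σ => ‖σ (x : K)‖) (fun φ => ‖φ x‖)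
    fun _ => by simp [RingHom.equivRatAlgHom_apply]] at h
  rw [← h, ← Algebra.coe_norm_int, Ideal.absNorm_span_singleton]
  simp [Nat.cast_natAbs]

theorem card_quotient_span_smul {L : Type*} [AddCommGroup L] [Module (𝓞 K) L]
    [Module.IsTorsionFree (𝓞 K) L] (x : 𝓞 K) {s : L} (hs : s ≠ 0) :
    Nat.card (L ⧸ Submodule.span (𝓞 K) {x • s}) =
      Ideal.absNorm (Ideal.span {x}) * Nat.card (L ⧸ Submodule.span (𝓞 K) {s}) := by
  let f : 𝓞 K →ₗ[𝓞 K] L := LinearMap.toSpanSingleton _ _ s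
  have hf : Function.Injective f := smul_left_injective (𝓞 K) hs
  have h1 : Submodule.map f (Ideal.span {x}) = Submodule.span (𝓞 K) {x • s} := by
    rw [Ideal.span, Submodule.map_span, Set.image_singleton]
    rfl
  have h2 : Submodule.map f (⊤ : Ideal (𝓞 K)) = Submodule.span (𝓞 K) {s} := by
    rw [Submodule.map_top, LinearMap.range_toSpanSingleton]
  have h3 := AddSubgroup.relIndex_map_map_of_injective (f := f.toAddMonoidHom)
    (Ideal.span {x}).toAddSubgroup (⊤ : Ideal (𝓞 K)).toAddSubgroup hf
  have h4 := AddSubgroup.relIndex_mul_index (H := (Submodule.span (𝓞 K) {x • s}).toAddSubgroup)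
    (K := (Submodule.span (𝓞 K) {s}).toAddSubgroup) (Submodule.span_singleton_smul_le _ _ _)
  rw [← h1, ← h2] at h4
  rw [← h1, ← h2, Ideal.absNorm_apply, Submodule.cardQuot_apply]
  refine h4.symm.trans (congrArg (· * _) (h3.trans ?_))
  exact AddSubgroup.relIndex_top_right _

theorem finite_quotient_span_singleton {L : Type*} [AddCommGroup L] [Module (𝓞 K) L]
    [Module.Finite (𝓞 K) L] {w : L} {m : 𝓞 K} (hm : m ≠ 0)
    (hw : ∀ z : L, m • z ∈ Submodule.span (𝓞 K) {w}) :
    Finite (L ⧸ Submodule.span (𝓞 K) {w}) := by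
  have : Module.Finite ℤ (L ⧸ Submodule.span (𝓞 K) {w}) := Module.Finite.trans (𝓞 K) _
  -- a nonzero multiple of `m` in `ℤ` annihilates the quotient
  obtain ⟨d, hd, hdm⟩ : ∃ d : ℤ, d ≠ 0 ∧ m ∣ (d : 𝓞 K) :=
    ⟨Ideal.absNorm (Ideal.span {m}), by simpa [Ideal.absNorm_eq_zero_iff] using hm,
      by simpa [Ideal.mem_span_singleton] using Ideal.absNorm_mem (Ideal.span {m})⟩
  refine Module.finite_of_fg_torsion _ fun z => ⟨⟨d, mem_nonZeroDivisors_of_ne_zero hd⟩, ?_⟩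
  obtain ⟨z, rfl⟩ := Submodule.mkQ_surjective (Submodule.span (𝓞 K) {w}) z
  obtain ⟨c, hc⟩ := hdm
  change d • Submodule.mkQ (Submodule.span (𝓞 K) {w}) z = 0
  rw [← map_zsmul, ← Int.cast_smul_eq_zsmul (𝓞 K), hc, mul_comm, mul_smul]
  exact (Submodule.Quotient.mk_eq_zero _).mpr (Submodule.smul_mem _ c (hw z))

variable {E : Type*} [AddCommGroup E] [Module (𝓞 K) E]

theorem linearIndependent_toFibre (σ : K →+* ℂ) {ι : Type*} {v : ι → E}
    (hv : LinearIndependent (𝓞 K) v) : LinearIndependent ℂ fun i => toFibre E σ (v i) :=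
  Module.Flat.linearIndependent_one_tmul (S := CEmb σ) hv

/-- The degree may be estimated with the wedge product `w` of any maximal independent family:
by the product formula the choice of the section does not matter, and the cardinality of the
quotient of the determinant by the line generated by `w` is at least one. -/
theorem neg_sum_log_extNorm_le_arakelovDegree [Module.Finite (𝓞 K) E] [Module.Projective (𝓞 K) E]
    (h : HermitianForms K E) {v : Fin (Module.finrank (𝓞 K) E) → E}
    (hv : LinearIndependent (𝓞 K) v) :
    -∑ σ : K →+* ℂ, Real.log
        (extNorm (h σ) (exteriorPower.ιMulti ℂ _ fun i => toFibre E σ (v i))) ≤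
      arakelovDegree h := by
  let n := Module.finrank (𝓞 K) E
  set w := exteriorPower.ιMulti (𝓞 K) n v
  have := projective_exteriorPower (R := 𝓞 K) (M := E) n
  have hpos (σ : K →+* ℂ) : 0 < extNorm (h σ) (extToFibre σ n w) := by
    rw [extToFibre_ιMulti]
    exact extNorm_ιMulti_pos _ (linearIndependent_toFibre σ hv)
  have hw : w ≠ 0 := fun hw => by
    obtain ⟨σ⟩ : Nonempty (K →+* ℂ) := inferInstance
    have h0 := hpos σ
    rw [hw, map_zero, ← zero_smul ℂ (0 : ⋀[ℂ]^n (Fibre E σ)), extNorm_smul] at h0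
    simp at h0
  obtain ⟨m, hm, hmv⟩ := exists_smul_mem_of_isTorsion_quotient
    (isTorsion_quotient_span_of_linearIndependent hv)
  have hmw (z) : m ^ n • z ∈ Submodule.span (𝓞 K) {w} := pow_smul_mem_span_ιMulti hv hmv z
  have hfin := finite_quotient_span_singleton (pow_ne_zero n hm) hmw
  have hex : ∃ s : ⋀[𝓞 K]^n E, s ≠ 0 := ⟨w, hw⟩
  rw [arakelovDegree, dif_pos hex]
  have hs : hex.choose ≠ 0 := hex.choose_spec
  set s := hex.choose
  -- `x • s = y • w` with nonzero `x` and `y`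
  obtain ⟨x, hx, y, hy, hxy⟩ : ∃ x : 𝓞 K, x ≠ 0 ∧ ∃ y : 𝓞 K, y ≠ 0 ∧ x • s = y • w := by
    obtain ⟨y, hy⟩ := Submodule.mem_span_singleton.mp (hmw s)
    refine ⟨_, pow_ne_zero n hm, y, ?_, hy.symm⟩
    rintro rfl
    rw [zero_smul] at hy
    exact smul_ne_zero (pow_ne_zero n hm) hs hy.symm
  have hN {a : 𝓞 K} (ha : a ≠ 0) : 0 < Ideal.absNorm (Ideal.span {a}) :=
    Nat.pos_of_ne_zero (by simpa [Ideal.absNorm_eq_zero_iff] using ha)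
  have hcw : 0 < Nat.card ((⋀[𝓞 K]^n E) ⧸ Submodule.span (𝓞 K) {w}) := Nat.card_pos
  have hcard : Ideal.absNorm (Ideal.span {x}) *
      Nat.card ((⋀[𝓞 K]^n E) ⧸ Submodule.span (𝓞 K) {s}) =
      Ideal.absNorm (Ideal.span {y}) * Nat.card ((⋀[𝓞 K]^n E) ⧸ Submodule.span (𝓞 K) {w}) := by
    rw [← card_quotient_span_smul x hs, ← card_quotient_span_smul y hw, hxy]
  have hcs : 0 < Nat.card ((⋀[𝓞 K]^n E) ⧸ Submodule.span (𝓞 K) {s}) :=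
    Nat.pos_of_mul_pos_left (hcard ▸ Nat.mul_pos (hN hy) hcw)
  have hlog := congrArg (fun k : ℕ => Real.log k) hcard
  simp only [Nat.cast_mul] at hlog
  rw [Real.log_mul (by exact_mod_cast (hN hx).ne') (by exact_mod_cast hcs.ne'),
    Real.log_mul (by exact_mod_cast (hN hy).ne') (by exact_mod_cast hcw.ne'),
    ← sum_log_norm_embeddings hx, ← sum_log_norm_embeddings hy] at hlog
  have hsum : ∑ σ : K →+* ℂ, Real.log ‖σ x‖ +
        ∑ σ : K →+* ℂ, Real.log (extNorm (h σ) (extToFibre σ n s)) =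
      ∑ σ : K →+* ℂ, Real.log ‖σ y‖ +
        ∑ σ : K →+* ℂ, Real.log (extNorm (h σ) (extToFibre σ n w)) := by
    rw [← Finset.sum_add_distrib, ← Finset.sum_add_distrib]
    refine Finset.sum_congr rfl fun σ _ => ?_
    have hxs := congrArg (fun z => extNorm (h σ) (extToFibre σ n z)) hxy
    simp only [map_smulₛₗ, extNorm_smul] at hxs
    have hσ {a : 𝓞 K} (ha : a ≠ 0) : ‖σ a‖ ≠ 0 := by simpa using ha
    have hs0 : extNorm (h σ) (extToFibre σ n s) ≠ 0 :=
      right_ne_zero_of_mul (hxs ▸ mul_ne_zero (hσ hy) (hpos σ).ne')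
    rw [← Real.log_mul (hσ hx) hs0, ← Real.log_mul (hσ hy) (hpos σ).ne']
    exact congrArg Real.log hxs
  have hcw0 : 0 ≤ Real.log (Nat.card ((⋀[𝓞 K]^n E) ⧸ Submodule.span (𝓞 K) {w})) :=
    Real.log_natCast_nonneg _
  simp only [← extToFibre_ιMulti]
  change -∑ σ : K →+* ℂ, Real.log (extNorm (h σ) (extToFibre σ n w)) ≤
    Real.log (Nat.card ((⋀[𝓞 K]^n E) ⧸ Submodule.span (𝓞 K) {s})) -
      ∑ σ : K →+* ℂ, Real.log (extNorm (h σ) (extToFibre σ n s))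
  linarith

end Degree

/-! ### Slopes of bundles generated by small sections -/

section Slopes

variable {K : Type*} [Field K] [NumberField K] {E : Type*} [AddCommGroup E] [Module (𝓞 K) E]
  [Module.Finite (𝓞 K) E]

/-- A bundle generated by sections of norm at most `b` has slope at least `-log b`. -/
theorem neg_log_le_slope [Module.Projective (𝓞 K) E] [Nontrivial E] (h : HermitianForms K E)
    {S : Set E} (hS : Submodule.span (𝓞 K) S = ⊤) {b : ℝ} (hb : 0 < b)
    (hSb : ∀ s ∈ S, ∀ σ : K →+* ℂ, formNorm (h σ) (toFibre E σ s) ≤ b) :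
    -Real.log b ≤ slope h := by
  obtain ⟨v, hv, hvS⟩ := exists_linearIndependent_fin_finrank hS
  have hn : 0 < Module.finrank (𝓞 K) E := Module.finrank_pos
  have hd : 0 < Module.finrank ℚ K := Module.finrank_pos
  rw [slope, le_div_iff₀ (by positivity)]
  refine le_trans ?_ (neg_sum_log_extNorm_le_arakelovDegree h hv)
  rw [neg_mul, neg_le_neg_iff]
  calc _ ≤ ∑ σ : K →+* ℂ, Module.finrank (𝓞 K) E * Real.log b := by
        refine Finset.sum_le_sum fun σ _ => ?_
        rw [← Real.log_pow]
        exact Real.log_le_log (extNorm_ιMulti_pos _ (linearIndependent_toFibre σ hv))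
          (extNorm_ιMulti_le_pow _ hb.le fun i => hSb _ (hvS i) σ)
    _ = _ := by
      rw [Finset.sum_const, Finset.card_univ, NumberField.Embeddings.card, nsmul_eq_mul]
      ring

/-- The bound of `neg_log_le_slope` passes to quotients, which are generated by the images of the
same sections, with smaller norms. -/
theorem neg_log_le_minSlope (h : HermitianForms K E) {S : Set E}
    (hS : Submodule.span (𝓞 K) S = ⊤) {b : ℝ} (hb : 0 < b)
    (hSb : ∀ s ∈ S, ∀ σ : K →+* ℂ, formNorm (h σ) (toFibre E σ s) ≤ b) :
    ((-Real.log b : ℝ) : EReal) ≤ minSlope h := by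
  refine le_iInf fun N => le_iInf fun hN => le_iInf fun _ => EReal.coe_le_coe_iff.mpr ?_
  have : Nontrivial (E ⧸ N) := Submodule.Quotient.nontrivial_iff.mpr hN
  refine neg_log_le_slope (S := N.mkQ '' S) _ ?_ hb ?_
  · rw [Submodule.span_image, hS, Submodule.map_top, Submodule.range_mkQ]
  · rintro _ ⟨s, hs, rfl⟩ σ
    exact (formNorm_quotientForm_le (h σ) (fibreMap σ N.mkQ) (fibreMap_mkQ_surjective σ N)
      (toFibre E σ s)).trans (hSb s hs σ)

end Slopes

end Arakelov

end

theorem mainTheorem7 {K : Type*} [Field K] [NumberField K]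
    {E : Type*} [AddCommGroup E] [Module (𝓞 K) E] [Module.Finite (𝓞 K) E]
    [Module.Projective (𝓞 K) E] [Nontrivial E]
    (g : Arakelov.Metric K E) (g' : Arakelov.HermitianMetric K E) (t : ℝ) :
    Arakelov.minimumFiltration g t ≤
      Arakelov.slopeFiltration g'
        (t - (Real.log (Real.sqrt (Module.finrank (𝓞 K) E)) +
          Arakelov.metricDist g g'.toMetric)) := by
  set D := Arakelov.metricDist g g'.toMetric
  set S := Arakelov.smallSections g (Real.exp (-t))
  let F := Submodule.span (𝓞 K) S
  have hF : ((-Real.log (Real.exp (D - t)) : ℝ) : EReal) ≤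
      Arakelov.minSlope (Arakelov.subForms g'.form F) := by
    refine Arakelov.neg_log_le_minSlope _ (S := Subtype.val ⁻¹' S) Submodule.span_span_coe_preimage
      (Real.exp_pos _) fun s hs σ => ?_
    -- the induced norm of a section of `F` is its norm in `E`
    change g'.toMetric.norm σ (Arakelov.toFibre E σ s) ≤ _
    refine (Arakelov.norm_le_exp_metricDist_mul g g'.toMetric σ _).trans ?_
    rw [sub_eq_add_neg, Real.exp_add]
    exact mul_le_mul_of_nonneg_left (hs σ) (Real.exp_pos _).le
  have hr : 0 ≤ Real.log (Real.sqrt (Module.finrank (𝓞 K) E)) := by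
    rw [Real.log_sqrt (Nat.cast_nonneg _)]
    exact div_nonneg (Real.log_natCast_nonneg _) zero_le_two
  refine le_trans ?_ (le_iSup₂_of_le F (le_trans (EReal.coe_le_coe_iff.mpr ?_) hF) le_rfl)
  · rw [Arakelov.minimumFiltration, Submodule.span_le]
    rintro _ ⟨s, hs, rfl⟩
    exact Submodule.tmul_mem_baseChange_of_mem 1 (Submodule.subset_span hs)
  · rw [Real.log_exp]
    linarith
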